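/- Let $m\ge 1$ be odd, $n=2m$, $q=2^m$, and regard $\mathbb F_{2^m}$ as the subfield of $\mathbb F_{2^n}$ with $2^m$ elements. Put $\mathrm{Tr}^n_m(x)=x+x^{2^m}$. A function $f:\mathbb F_{2^n}\to\mathbb F_{2^n}$ is called APN (almost perfect nonlinear) if the largest number of solutions $x\in\mathbb F_{2^n}$ of an equation $f(x)+f(x+d)=e$, over all $d,e\in\mathbb F_{2^n}$ with $d\ne 0$, is equal to $2$. An element of $\mathbb F_{2^n}$ is a cube if it equals $y^3$ for some $y\in\mathbb F_{2^n}$. Let $a\in\mathbb F_{2^n}\setminus\mathbb F_{2^m}$, let $b,c\in\mathbb F_{2^n}$ with $bc\ne 0$, let $s$ be an odd positive integer, and let $$f_s(x)=a\,\mathrm{Tr}^n_m(bx^3)+a^q\,\mathrm{Tr}^n_m(cx^{2^s+1}).$$ Then $f_s$ is APN over $\mathbb F_{2^n}$ if at least one of the following holds: (i) $s\equiv m-2 \pmod n$, $b$ is not a cube, and $c^4/b\in\mathbb F_{2^m}$; (ii) $s\equiv (m-2)^{-1} \pmod n$, $b$ is not a cube, and $c^{2^s-1}/b^{2^{2s}}\in\mathbb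 F_{2^m}$; (iii) $s=3$, $b$ is not a cube, and $c/b^3\in\mathbb F_{2^m}$; (iv) $\gcd(3,m)=1$, $3s\equiv 1\pmod n$, $b$ is not a cube, and $c^{2^{2s}-2^s+1}/b\in\mathbb F_{2^m}$; (v) $s=m$, $b$ is not a cube, and $c\notin\mathbb F_{2^m}$; (vi) $s=m+2$, $b$ is not a cube, and $bc\in\mathbb F_{2^m}$; (vii) $s=n-1$ and $c^2/b\notin\mathbb F_{2^m}$. In particular, if $b$ is not a cube in $\mathbb F_{2^n}$, then $a\,\mathrm{Tr}^n_m(bx^3)+a^q\,\mathrm{Tr}^n_m(b^3x^9)$ is APN over $\mathbb F_{2^n}$. (No pair $b,c$ satisfies the conditions in (iv).) -/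

import Mathlib

/-- `IsCube x`: the element `x` is the third power of some element of the field. -/
def IsCube {F : Type*} [Field F] (x : F) : Prop := ∃ y : F, x = y ^ 3

/-- The trace `Tr^n_m(x) = x + x^(2^m) + x^(2^(2m)) + ⋯ + x^(2^((n/m-1)m))` from the field with
`2^n` elements to the field with `2^m` elements (`m ∣ n`), as an element of the large field. -/
def traceTwo {F : Type*} [Field F] (n m : ℕ) (x : F) : F :=
  ∑ i ∈ Finset.range (n / m), x ^ (2 ^ (i * m))

/-- The number of solutions `x` of `f(x) + f(x + d) = e`. -/
noncomputable def derivCount {F : Type*} [Field F] (f : F → F) (d e : F) : ℕ :=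
  Set.ncard {x : F | f x + f (x + d) = e}

/-- `f` is differentially `δ`-uniform: the largest value of `derivCount f d e`, over all nonzero
directions `d` and all `e`, is equal to `δ`. -/
def IsDifferentiallyUniform {F : Type*} [Field F] (f : F → F) (δ : ℕ) : Prop :=
  IsGreatest {k : ℕ | ∃ d e : F, d ≠ 0 ∧ derivCount f d e = k} δ

/-- Almost perfect nonlinear: differentially `2`-uniform. -/
def IsAPN {F : Type*} [Field F] (f : F → F) : Prop := IsDifferentiallyUniform f 2

/-- `f_s(x) = a Tr^n_m(b x^3) + a^(2^m) Tr^n_m(c x^(2^s+1))`. -/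
def quadrinomial {F : Type*} [Field F] (n m s : ℕ) (a b c : F) (x : F) : F :=
  a * traceTwo n m (b * x ^ 3) + a ^ (2 ^ m) * traceTwo n m (c * x ^ (2 ^ s + 1))

/-!
Write `τ x = x ^ 2 ^ m` for the conjugation over the subfield `K` and `tr x = x + τ x`. Since `a` and
`τ a` are independent over `K`, and both summands of the quadrinomial are quadratic maps, the function
is APN as soon as, for every `d ≠ 0`,
`tr (b * d ^ 3 * (y ^ 2 + y)) = 0` and `tr (c * d ^ (2 ^ s + 1) * (y ^ 2 ^ s + y)) = 0`
force `y = 0` or `y = 1` (`quadrinomial_isAPN`). In characteristic two, `tr x = 0` means `τ x = x`.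

Every element of `K` is a cube because `m` is odd. If `b` is not a cube then neither is
`u = b * d ^ 3`, and if `u * v` lies in `K` for some `v ≠ 0` then `v` is not a cube either. A
contradiction comes from showing that `v = σ y + y` is a cube for an odd Frobenius power `σ`.
By a Hilbert 90 argument this is so as soon as `y` or `y + 1` has norm `1`
(`isCube_of_norm_eq_one_or`).

With `T` and `N` the trace and norm of `y`, eliminating the coefficients from the two conditions
leaves an equation in `T` and `N` alone. For `s = m ± 2` and for `s = (m - 2)⁻¹` it says that the
vectors `(1, 1, 1)`, `(T, σ T, σ² T)`, `(N, σ N, σ² N)` are linearly dependent; as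
`T ≠ σ T` (otherwise `v` would lie in `K`), one concludes that `N` or `N + T + 1`, the norm of `y + 1`, lies in the prime field (`eq_zero_or_one_of_trace`). For `s = 3`
there is one further solution, which makes the minimal polynomial of `y` split over `K`
(`eq_zero_or_one_of_trace_nine`). The remaining exponents `m` and `n - 1` follow directly, and the
condition with `3 * s ≡ 1` is never satisfied.
-/

/-! ### Cubes -/

theorem IsCube.mul {F : Type*} [Field F] {x y : F} (hx : IsCube x) (hy : IsCube y) :
    IsCube (x * y) := by
  obtain ⟨u, rfl⟩ := hx
  obtain ⟨v, rfl⟩ := hy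
  exact ⟨u * v, by ring⟩

theorem IsCube.div {F : Type*} [Field F] {x y : F} (hx : IsCube x) (hy : IsCube y) :
    IsCube (x / y) := by
  obtain ⟨u, rfl⟩ := hx
  obtain ⟨v, rfl⟩ := hy
  exact ⟨u / v, by rw [div_pow]⟩

theorem IsCube.of_mul_left {F : Type*} [Field F] {x y : F} (hx : IsCube x) (hx0 : x ≠ 0)
    (hxy : IsCube (x * y)) : IsCube y := by
  have := hxy.div hx
  rwa [mul_div_cancel_left₀ y hx0] at this

theorem IsCube.map {F : Type*} [Field F] {x : F} (σ : F →+* F) (hx : IsCube x) :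
    IsCube (σ x) := by
  obtain ⟨u, rfl⟩ := hx
  exact ⟨σ u, map_pow σ u 3⟩

theorem isCube_pow_of_dvd {F : Type*} [Field F] {k : ℕ} (hk : 3 ∣ k) (x : F) :
    IsCube (x ^ k) := by
  obtain ⟨j, rfl⟩ := hk
  exact ⟨x ^ j, by rw [← pow_mul, mul_comm]⟩

theorem not_isCube_ne_zero {F : Type*} [Field F] {x : F} (hx : ¬ IsCube x) : x ≠ 0 := by
  rintro rfl
  exact hx ⟨0, by simp⟩

theorem not_isCube_mul_pow_three {F : Type*} [Field F] {b d : F} (hb : ¬ IsCube b) (hd : d ≠ 0) :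
    ¬ IsCube (b * d ^ 3) := fun h ↦
  hb (IsCube.of_mul_left ⟨d, rfl⟩ (pow_ne_zero 3 hd) (by rwa [mul_comm]))

theorem three_dvd_two_pow_add_one {s : ℕ} (hs : Odd s) : 3 ∣ 2 ^ s + 1 := by
  simpa using hs.nat_add_dvd_pow_add_pow 2 1

/-! ### The conjugation and a Frobenius power, abstractly -/

section Conjugation

variable {F : Type*} [Field F] [CharP F 2] {τ σ : F →+* F}

/-- With `z = 1 + τ y`, so that `y = τ z / z` as in Hilbert's Theorem 90, the product
`(σ y + y) * (z * σ z)` is fixed by `τ`. -/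
theorem isCube_of_norm_eq_one (hττ : ∀ x, τ (τ x) = x) (hτσ : ∀ x, τ (σ x) = σ (τ x))
    (hfix : ∀ x, τ x = x → IsCube x) (hσ : ∀ x, IsCube (x * σ x))
    {y : F} (hy : y * τ y = 1) : IsCube (σ y + y) := by
  by_cases hz : 1 + τ y = 0
  · have h1 : τ y = 1 := (CharTwo.add_eq_zero.mp hz).symm
    rw [h1, mul_one] at hy
    rw [hy, map_one, CharTwo.add_self_eq_zero]
    exact ⟨0, by simp⟩
  · have hσy : σ y * σ (τ y) = 1 := by rw [← map_mul, hy, map_one]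
    refine (hσ (1 + τ y)).of_mul_left (mul_ne_zero hz ((map_ne_zero σ).mpr hz)) (hfix _ ?_)
    simp only [map_mul, map_add, map_one, hττ, hτσ]
    have h2 : (2 : F) = 0 := CharTwo.two_eq_zero
    grind

/-- The image of `y` under the Artin–Schreier type map `y ↦ σ y + y` does not change when `1` is
added to `y`, so `1 + y` may take the place of `y` in `isCube_of_norm_eq_one`. -/
theorem isCube_of_norm_eq_one_or (hττ : ∀ x, τ (τ x) = x) (hτσ : ∀ x, τ (σ x) = σ (τ x))
    (hfix : ∀ x, τ x = x → IsCube x) (hσ : ∀ x, IsCube (x * σ x))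
    {y : F} (hy : y * τ y = 1 ∨ (y + 1) * τ (y + 1) = 1) : IsCube (σ y + y) := by
  rcases hy with hy | hy
  · exact isCube_of_norm_eq_one hττ hτσ hfix hσ hy
  · have := isCube_of_norm_eq_one hττ hτσ hfix hσ hy
    rw [map_add, map_one] at this
    have h2 : (2 : F) = 0 := CharTwo.two_eq_zero
    convert this using 1
    linear_combination -h2

omit [CharP F 2] in
theorem not_isCube_of_mul_fixed (hfix : ∀ x, τ x = x → IsCube x) {w v : F} (hw : ¬ IsCube w)
    (hv : v ≠ 0) (h : τ (w * v) = w * v) : ¬ IsCube v := fun hc ↦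
  hw (hc.of_mul_left hv (by rw [mul_comm]; exact hfix _ h))

/-- With `T = y + τ y` and `N = y * τ y`, the two trace conditions say that
`(N + σ N) / (T + σ T)` is fixed by `σ`. So it is `0` or `1`, and then `y` or `y + 1` has norm
`0` or `1`. -/
theorem eq_zero_or_one_of_trace (hττ : ∀ x, τ (τ x) = x) (hτσ : ∀ x, τ (σ x) = σ (τ x))
    (hfix : ∀ x, τ x = x → IsCube x) (hσ : ∀ x, IsCube (x * σ x))
    (hσfix : ∀ x, σ x = x → x = 0 ∨ x = 1) {w y : F} (hw : ¬ IsCube w)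
    (h1 : τ (w * (σ y + y)) = w * (σ y + y))
    (h2 : τ (σ w / w * (σ (σ y) + τ y)) = σ w / w * (σ (σ y) + τ y)) :
    y = 0 ∨ y = 1 := by
  by_contra hy
  have two : (2 : F) = 0 := CharTwo.two_eq_zero
  have hw0 := not_isCube_ne_zero hw
  have hv0 : σ y + y ≠ 0 := fun h ↦ hy (hσfix y (CharTwo.add_eq_zero.mp h))
  have hv := not_isCube_of_mul_fixed hfix hw hv0 h1
  have hσw0 : σ w ≠ 0 := by simpa using hw0
  have hτw0 : τ w ≠ 0 := by simpa using hw0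
  have h1σ := congrArg σ h1
  simp only [map_mul, map_add, map_div₀, hττ, hτσ] at h1 h2 h1σ
  have hστw0 : σ (τ w) ≠ 0 := by simpa using hw0
  -- Eliminating `w` between the two conditions.
  have h3 : σ (τ w) * w * (σ (σ (τ y)) + y) = σ w * τ w * (σ (σ y) + τ y) := by
    field_simp at h2
    linear_combination h2
  have h4 : (σ y + σ (σ y)) * (τ y + σ (τ y)) * (σ (σ (τ y)) + y) =
      (σ (τ y) + σ (σ (τ y))) * (y + σ y) * (σ (σ y) + τ y) := by
    apply mul_left_cancel₀ (mul_ne_zero hσw0 hw0)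
    linear_combination (σ (σ (τ y)) + σ (τ y)) * (σ (τ y) + τ y) * h3
      - w * (σ (τ y) + τ y) * (σ (σ (τ y)) + y) * h1σ
      + σ w * (σ (σ (τ y)) + σ (τ y)) * (σ (σ y) + τ y) * h1
  have hT : y + τ y + (σ y + σ (τ y)) ≠ 0 := fun h ↦ hv (hfix _ (by
    rw [map_add, hτσ]; linear_combination h - (y + σ y) * two))
  have hT' : σ y + σ (τ y) + (σ (σ y) + σ (σ (τ y))) ≠ 0 := by
    have := (map_ne_zero σ).mpr hT
    simpa only [map_add] using this
  have h5 : (σ y * σ (τ y) + σ (σ y) * σ (σ (τ y))) * (y + τ y + (σ y + σ (τ y))) =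
      (y * τ y + σ y * σ (τ y)) * (σ y + σ (τ y) + (σ (σ y) + σ (σ (τ y)))) := by
    grind
  have h6 := hσfix ((y * τ y + σ y * σ (τ y)) / (y + τ y + (σ y + σ (τ y)))) (by
    simp only [map_div₀, map_add, map_mul]
    rw [div_eq_div_iff hT' hT, h5])
  refine hv (isCube_of_norm_eq_one_or hττ hτσ hfix hσ ?_)
  rcases h6 with h6 | h6
  · rw [div_eq_zero_iff, or_iff_left hT, CharTwo.add_eq_zero] at h6
    rcases hσfix (y * τ y) (by rw [map_mul, ← h6]) with h | h
    · rcases mul_eq_zero.mp h with h | h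
      · exact absurd (Or.inl h) hy
      · exact absurd (Or.inl ((map_eq_zero τ).mp h)) hy
    · exact Or.inl h
  · rw [div_eq_one_iff_eq hT] at h6
    rcases hσfix ((y + 1) * τ (y + 1)) (by
      simp only [map_mul, map_add, map_one]
      linear_combination h6 + (σ y + σ (τ y) - y * τ y) * two) with h | h
    · have hy1 : y + 1 = 0 := by
        rcases mul_eq_zero.mp h with h | h
        · exact h
        · exact (map_eq_zero τ).mp h
      exact absurd (Or.inr (CharTwo.add_eq_zero.mp hy1)) hy
    · exact Or.inr h

/-- The case of exponents `3` and `9`. With `v = y ^ 2 + y`, `T = y + τ y` and `N = v * τ v`,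
the conditions give `(N + T) * (N + T + 1) = 0`. If `N = T`, then `y` or `y + 1` has norm `1`. If
`N = T + 1`, the quadratic with roots `y` and `τ y` has a root fixed by `τ`. -/
theorem eq_zero_or_one_of_trace_nine (hττ : ∀ x, τ (τ x) = x)
    (hfix : ∀ x, τ x = x → IsCube x) {u y : F} (hu : ¬ IsCube u)
    (h1 : τ (u * (y ^ 2 + y)) = u * (y ^ 2 + y))
    (h2 : τ (u ^ 3 * (y ^ 8 + y)) = u ^ 3 * (y ^ 8 + y)) :
    y = 0 ∨ y = 1 := by
  by_contra hy
  have two : (2 : F) = 0 := CharTwo.two_eq_zero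
  have hu0 := not_isCube_ne_zero hu
  have hv0 : y ^ 2 + y ≠ 0 := fun h ↦
    hy (eq_zero_or_one_of_sq_eq_self (CharTwo.add_eq_zero.mp h))
  have hv := not_isCube_of_mul_fixed hfix hu hv0 h1
  have hτv0 : τ y ^ 2 + τ y ≠ 0 := by
    simpa using (map_ne_zero τ).mpr hv0
  have hyτ : τ y ≠ y := fun h ↦ hv (hfix _ (by simp [h]))
  simp only [map_mul, map_add, map_pow] at h1 h2
  have h3 : (y ^ 8 + y) * (τ y ^ 2 + τ y) ^ 3 = (τ y ^ 8 + τ y) * (y ^ 2 + y) ^ 3 := by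
    apply mul_left_cancel₀ (pow_ne_zero 3 hu0)
    have h1' : τ u ^ 3 * (τ y ^ 2 + τ y) ^ 3 = u ^ 3 * (y ^ 2 + y) ^ 3 := by
      rw [← mul_pow, h1, mul_pow]
    linear_combination (τ y ^ 8 + τ y) * h1' - (τ y ^ 2 + τ y) ^ 3 * h2
  -- Trace and norm of `y`; the norm of `y ^ 2 + y` is `N * (N + T + 1)`.
  obtain ⟨T, hT⟩ : ∃ T, T = y + τ y := ⟨_, rfl⟩
  obtain ⟨N, hN⟩ : ∃ N, N = y * τ y := ⟨_, rfl⟩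
  have ht : T ^ 2 + T ≠ 0 := fun h ↦ hv (hfix _ (by
    simp only [map_add, map_pow]
    rw [hT] at h
    linear_combination h - (y * τ y + y ^ 2 + y) * two))
  have h4 : (N * (N + T + 1) + T) * (N * (N + T + 1) + T + 1) = 0 := by
    apply mul_left_cancel₀ (mul_ne_zero (mul_ne_zero hv0 hτv0) ht)
    rw [mul_zero]
    have e : ∀ z : F, z ^ 8 + z = (z ^ 2 + z) ^ 4 + (z ^ 2 + z) ^ 2 + (z ^ 2 + z) := fun z ↦ by
      grind
    rw [e, e] at h3
    obtain ⟨v, hvv⟩ : ∃ v, v = y ^ 2 + y := ⟨_, rfl⟩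
    obtain ⟨v', hvv'⟩ : ∃ v', v' = τ y ^ 2 + τ y := ⟨_, rfl⟩
    have e1 : N * (N + T + 1) = v * v' := by rw [hN, hT, hvv, hvv']; ring
    have e2 : T ^ 2 + T = v + v' := by rw [hT, hvv, hvv']; grind
    have e3 : (v * v' + T) * (v * v' + T + 1) = (v * v') ^ 2 + v * v' + (v + v') := by
      rw [← e2]; grind
    rw [e1, e2, ← hvv, ← hvv', mul_assoc, e3]
    rw [← hvv, ← hvv'] at h3
    grind
  rcases mul_eq_zero.mp h4 with h | h
  · have h5 : (N + 1) * (N + T) = 0 := by linear_combination h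
    have hc := isCube_of_norm_eq_one_or (τ := τ) (σ := frobenius F 2) hττ
      (fun x ↦ by simp [frobenius_def]) hfix (fun x ↦ ⟨x, by rw [frobenius_def]; ring⟩)
      (y := y) (by
        rcases mul_eq_zero.mp h5 with h | h
        · left; rw [← hN]; exact CharTwo.add_eq_zero.mp h
        · right
          rw [hN, hT] at h
          rw [map_add, map_one]
          linear_combination h)
    exact hv (by simpa [frobenius_def] using hc)
  · have hN1 : N + 1 ≠ 0 := fun h0 ↦ one_ne_zero (α := F) (by
      linear_combination h - (N + T) * h0)
    have hNτ : τ N = N := by rw [hN, map_mul, hττ, mul_comm]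
    have h5 : (y + (N + 1)) * (y * (N + 1) + N) = 0 := by grind
    rcases mul_eq_zero.mp h5 with h | h
    · refine hyτ ?_
      rw [CharTwo.add_eq_zero.mp h, map_add, map_one, hNτ]
    · refine hyτ ?_
      rw [show y = N / (N + 1) by
        rw [eq_div_iff hN1]; exact CharTwo.add_eq_zero.mp h, map_div₀, map_add, map_one, hNτ]

end Conjugation

/-! ### Powers of the Frobenius in the field with `2 ^ n` elements -/

theorem pow_two_pow_eq_of_modEq {F : Type*} [Field F] {n : ℕ} (hF : Nat.card F = 2 ^ n)
    {i j : ℕ} (h : i ≡ j [MOD n]) (x : F) : x ^ 2 ^ i = x ^ 2 ^ j := by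
  have : Finite F := Nat.finite_of_card_ne_zero (by rw [hF]; positivity)
  have := Fintype.ofFinite F
  have key (k l : ℕ) : x ^ 2 ^ (k + n * l) = x ^ 2 ^ k := by
    rw [pow_add, pow_mul 2 n l, ← hF, pow_mul, Nat.card_eq_fintype_card,
      FiniteField.pow_card_pow]
  rw [← Nat.mod_add_div i n, ← Nat.mod_add_div j n, key, key, h]

theorem eq_zero_or_one_of_pow_two_pow_eq {F : Type*} [Field F] {n : ℕ} (hF : Nat.card F = 2 ^ n)
    {s k : ℕ} (h : s * k ≡ 1 [MOD n]) {x : F} (hx : x ^ 2 ^ s = x) : x = 0 ∨ x = 1 := by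
  have key (j : ℕ) : x ^ 2 ^ (s * j) = x := by
    induction j with
    | zero => simp
    | succ j ih => rw [Nat.mul_succ, pow_add, pow_mul, ih, hx]
  have h2 := pow_two_pow_eq_of_modEq hF h x
  rw [key, pow_one] at h2
  exact eq_zero_or_one_of_sq_eq_self h2.symm

theorem mem_subfield_iff_pow_eq {F : Type*} [Field F] (K : Subfield F) {q : ℕ} (hq : 1 < q)
    (hK : Nat.card K = q) (x : F) : x ∈ K ↔ x ^ q = x := by
  have : Finite K := Nat.finite_of_card_ne_zero (by omega)
  have := Fintype.ofFinite K
  classical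
  rw [Nat.card_eq_fintype_card] at hK
  subst hK
  constructor
  · intro hx
    exact congrArg Subtype.val (FiniteField.pow_card (⟨x, hx⟩ : K))
  · intro hx
    -- The set of roots of `X ^ q - X` has at most `q` elements and contains `K`.
    open Polynomial in
    have hne : (X ^ Fintype.card K - X : F[X]) ≠ 0 :=
      FiniteField.X_pow_card_sub_X_ne_zero F hq
    open Polynomial in
    have hsub : (Finset.univ : Finset K).map (Function.Embedding.subtype _) ⊆
        (X ^ Fintype.card K - X : F[X]).roots.toFinset := by
      intro z hz
      obtain ⟨k, -, rfl⟩ := Finset.mem_map.mp hz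
      rw [Multiset.mem_toFinset, mem_roots hne]
      simpa [sub_eq_zero] using congrArg Subtype.val (FiniteField.pow_card k)
    open Polynomial in
    have heq := Finset.eq_of_subset_of_card_le hsub (by
      refine (Multiset.toFinset_card_le _).trans ((card_roots' _).trans ?_)
      rw [FiniteField.X_pow_card_sub_X_natDegree_eq F hq]
      simp)
    open Polynomial in
    have hmem : x ∈ (X ^ Fintype.card K - X : F[X]).roots.toFinset := by
      rw [Multiset.mem_toFinset, mem_roots hne]
      simp [hx]
    rw [← heq] at hmem
    obtain ⟨k, -, rfl⟩ := Finset.mem_map.mp hmem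
    exact k.2

/-- As `2 ^ m ≡ 2` modulo `3`, the exponent `2 * 2 ^ m - 1` is divisible by `3`; it acts as the
identity on the solutions of `x ^ 2 ^ m = x`. -/
theorem isCube_of_pow_eq {F : Type*} [Field F] {m : ℕ} (hm : Odd m) {x : F}
    (hx : x ^ 2 ^ m = x) : IsCube x := by
  by_cases h0 : x = 0
  · exact ⟨0, by simp [h0]⟩
  obtain ⟨j, hj⟩ := three_dvd_two_pow_add_one hm
  have hjm : 2 * 2 ^ m - 1 = 3 * (2 * j - 1) := by omega
  have h1 : 1 ≤ 2 ^ m := Nat.one_le_two_pow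
  have : x ^ (2 * 2 ^ m - 1) = x := by
    apply mul_right_cancel₀ h0
    rw [← pow_succ, show 2 * 2 ^ m - 1 + 1 = 2 ^ m * 2 by omega, pow_mul, hx, pow_two]
  rw [← this]
  exact isCube_pow_of_dvd ⟨_, hjm⟩ x

/-! ### Reduction of the APN property to a kernel condition -/

theorem traceTwo_two_mul {F : Type*} [Field F] {m : ℕ} (hm : 0 < m) (x : F) :
    traceTwo (2 * m) m x = x + x ^ 2 ^ m := by
  rw [traceTwo, Nat.mul_div_cancel _ hm]
  simp [Finset.sum_range_succ]

theorem isAPN_of_kernel {F : Type*} [Field F] [CharP F 2] {f : F → F}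
    (h : ∀ d y z : F, d ≠ 0 → f (d * y) + f (d * y + d) = f (d * z) + f (d * z + d) →
      y + z = 0 ∨ y + z = 1) : IsAPN f := by
  have two : (2 : F) = 0 := CharTwo.two_eq_zero
  have hsol (d e x z : F) (hd : d ≠ 0) (hx : f x + f (x + d) = e) (hz : f z + f (z + d) = e) :
      x = z ∨ x = z + d := by
    have := h d (x / d) (z / d) hd (by simp only [mul_div_cancel₀ _ hd]; rw [hx, hz])
    rcases this with h | h
    · rw [← add_div, div_eq_zero_iff, or_iff_left hd] at h
      exact Or.inl (CharTwo.add_eq_zero.mp h)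
    · rw [← add_div, div_eq_one_iff_eq hd] at h
      exact Or.inr (by linear_combination h - z * two)
  constructor
  · refine ⟨1, f 0 + f 1, one_ne_zero, ?_⟩
    have : {x : F | f x + f (x + 1) = f 0 + f 1} = {0, 1} := by
      ext x
      simp only [Set.mem_ofPred_eq, Set.mem_insert_iff, Set.mem_singleton_iff]
      constructor
      · intro hx
        simpa using hsol 1 _ x 0 one_ne_zero hx (by rw [zero_add])
      · rintro (rfl | rfl)
        · rw [zero_add]
        · rw [CharTwo.add_self_eq_zero, add_comm]
    rw [derivCount, this]
    exact Set.ncard_pair zero_ne_one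
  · rintro k ⟨d, e, hd, rfl⟩
    rw [derivCount]
    rcases Set.eq_empty_or_nonempty {x : F | f x + f (x + d) = e} with h0 | ⟨z, hz⟩
    · simp [h0]
    · have hsub : {x : F | f x + f (x + d) = e} ⊆ {z, z + d} := fun x hx ↦ by
        simpa using hsol d e x z hd hx hz
      exact (Set.ncard_le_ncard hsub (by simp)).trans ((Set.ncard_insert_le _ _).trans (by simp))

/-- An element outside the fixed field of an involution `τ` and its conjugate are linearly
independent over the fixed field. -/
theorem eq_zero_of_mul_add_conj_mul {F : Type*} [Field F] [CharP F 2] {τ : F →+* F}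
    (hττ : ∀ x, τ (τ x) = x) {a p r : F} (ha : τ a ≠ a) (hp : τ p = p) (hr : τ r = r)
    (h : a * p + τ a * r = 0) : p = 0 ∧ r = 0 := by
  have two : (2 : F) = 0 := CharTwo.two_eq_zero
  have h' := congrArg τ h
  simp only [map_add, map_mul, hττ, hp, hr, map_zero] at h'
  have ha' : a + τ a ≠ 0 := fun h ↦ ha (CharTwo.add_eq_zero.mp h).symm
  have hpr : p = r := by
    apply CharTwo.add_eq_zero.mp
    exact (mul_eq_zero.mp (show (a + τ a) * (p + r) = 0 by linear_combination h + h')).resolve_left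
      ha'
  subst hpr
  have := (mul_eq_zero.mp (show (a + τ a) * p = 0 by linear_combination h)).resolve_left ha'
  exact ⟨this, this⟩

theorem quadrinomial_isAPN {F : Type*} [Field F] [CharP F 2] {m : ℕ} (hm : 0 < m)
    {τ : F →+* F} (hτ : ∀ x, τ x = x ^ 2 ^ m) (hττ : ∀ x, τ (τ x) = x) {a : F} (ha : τ a ≠ a)
    {s : ℕ} {b c : F}
    (h : ∀ d y : F, d ≠ 0 → τ (b * d ^ 3 * (y ^ 2 + y)) = b * d ^ 3 * (y ^ 2 + y) →
      τ (c * d ^ (2 ^ s + 1) * (y ^ 2 ^ s + y)) = c * d ^ (2 ^ s + 1) * (y ^ 2 ^ s + y) →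
      y = 0 ∨ y = 1) :
    IsAPN (quadrinomial (2 * m) m s a b c) := by
  have two : (2 : F) = 0 := CharTwo.two_eq_zero
  refine isAPN_of_kernel fun d y z hd hyz ↦ ?_
  simp only [quadrinomial, traceTwo_two_mul hm, ← hτ] at hyz
  -- The derivative in direction `d` at `d * y` is an affine function of `y`.
  have e1 (x : F) : b * (d * x) ^ 3 + b * (d * x + d) ^ 3 =
      b * d ^ 3 * (x ^ 2 + x) + b * d ^ 3 := by
    linear_combination (b * d ^ 3 * x * (1 + x + x ^ 2)) * two
  have e2 (x : F) : c * (d * x) ^ (2 ^ s + 1) + c * (d * x + d) ^ (2 ^ s + 1) =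
      c * d ^ (2 ^ s + 1) * (x ^ 2 ^ s + x) + c * d ^ (2 ^ s + 1) := by
    rw [pow_succ, pow_succ, pow_succ, add_pow_char_pow, mul_pow]
    linear_combination (c * d ^ 2 ^ s * x ^ 2 ^ s * d * x) * two
  have hsq (u v : F) : (u + v) ^ 2 = u ^ 2 + v ^ 2 := add_pow_char u v 2
  have key := eq_zero_of_mul_add_conj_mul (τ := τ) hττ ha
    (p := b * d ^ 3 * ((y + z) ^ 2 + (y + z)) + τ (b * d ^ 3 * ((y + z) ^ 2 + (y + z))))
    (r := c * d ^ (2 ^ s + 1) * ((y + z) ^ 2 ^ s + (y + z)) +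
      τ (c * d ^ (2 ^ s + 1) * ((y + z) ^ 2 ^ s + (y + z))))
    (by rw [map_add, hττ, add_comm]) (by rw [map_add, hττ, add_comm]) (by
      have f1 : b * d ^ 3 * ((y + z) ^ 2 + (y + z)) =
          (b * (d * y) ^ 3 + b * (d * y + d) ^ 3) + (b * (d * z) ^ 3 + b * (d * z + d) ^ 3) := by
        rw [e1, e1, hsq]; linear_combination -(b * d ^ 3) * two
      have f2 : c * d ^ (2 ^ s + 1) * ((y + z) ^ 2 ^ s + (y + z)) =
          (c * (d * y) ^ (2 ^ s + 1) + c * (d * y + d) ^ (2 ^ s + 1)) +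
          (c * (d * z) ^ (2 ^ s + 1) + c * (d * z + d) ^ (2 ^ s + 1)) := by
        rw [e2, e2, add_pow_char_pow]; linear_combination -(c * d ^ (2 ^ s + 1)) * two
      rw [f1, f2]
      rw [← CharTwo.add_eq_zero] at hyz
      rw [← hyz]
      simp only [map_add]
      ring)
  exact h d _ hd (CharTwo.add_eq_zero.mp key.1).symm (CharTwo.add_eq_zero.mp key.2).symm

/-! ### The families of exponents -/

section Families

variable {F : Type*} [Field F] [CharP F 2] {τ : F →+* F}

omit [CharP F 2] in
theorem fixed_of_mul_fixed {k x : F} (hk : τ k = k) (hk0 : k ≠ 0) (h : τ (k * x) = k * x) :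
    τ x = x := by
  rw [map_mul, hk] at h
  exact mul_left_cancel₀ hk0 h

theorem eq_zero_or_one_of_trace_four (hττ : ∀ x, τ (τ x) = x) (hfix : ∀ x, τ x = x → IsCube x)
    {u y : F} (hu : ¬ IsCube u) (h1 : τ (u * (y ^ 2 + y)) = u * (y ^ 2 + y))
    (h2 : τ (u * (y ^ 4 + τ y)) = u * (y ^ 4 + τ y)) : y = 0 ∨ y = 1 := by
  have hu0 := not_isCube_ne_zero hu
  refine eq_zero_or_one_of_trace (σ := frobenius F 2) hττ (fun x ↦ by simp [frobenius_def]) hfix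
    (fun x ↦ ⟨x, by rw [frobenius_def]; ring⟩) (fun x hx ↦ eq_zero_or_one_of_sq_eq_self hx) hu
    (by simpa [frobenius_def] using h1) ?_
  have e : frobenius F 2 u / u * (frobenius F 2 (frobenius F 2 y) + τ y) =
      u * (y ^ 4 + τ y) := by
    simp only [frobenius_def]
    field_simp
  rw [e, h2]

theorem eq_zero_or_one_of_pow_mul_four (hττ : ∀ x, τ (τ x) = x)
    (hfix : ∀ x, τ x = x → IsCube x) {s : ℕ} (hs : ∀ x : F, (x ^ 2 ^ s) ^ 4 = τ x) {b c d y : F}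
    (hb : ¬ IsCube b) (hc : c ≠ 0) (hd : d ≠ 0) (hcb : τ (c ^ 4 / b) = c ^ 4 / b)
    (h1 : τ (b * d ^ 3 * (y ^ 2 + y)) = b * d ^ 3 * (y ^ 2 + y))
    (h2 : τ (c * d ^ (2 ^ s + 1) * (y ^ 2 ^ s + y)) = c * d ^ (2 ^ s + 1) * (y ^ 2 ^ s + y)) :
    y = 0 ∨ y = 1 := by
  have hb0 := not_isCube_ne_zero hb
  have hτd : τ d ≠ 0 := by simpa using hd
  refine eq_zero_or_one_of_trace_four hττ hfix (not_isCube_mul_pow_three hb hd) h1 ?_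
  refine fixed_of_mul_fixed (k := c ^ 4 / b * (d * τ d)) ?_
    (mul_ne_zero (div_ne_zero (pow_ne_zero 4 hc) hb0) (mul_ne_zero hd hτd)) ?_
  · rw [map_mul, hcb, map_mul, hττ, mul_comm d]
  · have e : c ^ 4 / b * (d * τ d) * (b * d ^ 3 * (y ^ 4 + τ y)) =
        (c * d ^ (2 ^ s + 1) * (y ^ 2 ^ s + y)) ^ 4 := by
      have h4 : (y ^ 2 ^ s + y) ^ 4 = τ y + y ^ 4 := by
        rw [← hs y]
        exact add_pow_char_pow (p := 2) (n := 2) (x := y ^ 2 ^ s) (y := y)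
      rw [mul_pow, mul_pow, h4, pow_succ d (2 ^ s), mul_pow, hs]
      field_simp
      ring
    rw [e, map_pow, h2]

theorem eq_zero_or_one_of_pow_eq_pow_four (hττ : ∀ x, τ (τ x) = x)
    (hfix : ∀ x, τ x = x → IsCube x) {s : ℕ} (hs : ∀ x : F, x ^ 2 ^ s = τ x ^ 4) {b c d y : F}
    (hb : ¬ IsCube b) (hc : c ≠ 0) (hd : d ≠ 0) (hbc : τ (b * c) = b * c)
    (h1 : τ (b * d ^ 3 * (y ^ 2 + y)) = b * d ^ 3 * (y ^ 2 + y))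
    (h2 : τ (c * d ^ (2 ^ s + 1) * (y ^ 2 ^ s + y)) = c * d ^ (2 ^ s + 1) * (y ^ 2 ^ s + y)) :
    y = 0 ∨ y = 1 := by
  have hb0 := not_isCube_ne_zero hb
  have hτb : τ b ≠ 0 := by simpa using hb0
  have hτc : τ c ≠ 0 := by simpa using hc
  have hτd : τ d ≠ 0 := by simpa using hd
  refine eq_zero_or_one_of_trace_four hττ hfix (not_isCube_mul_pow_three hb hd) h1 ?_
  rw [map_mul] at hbc
  refine fixed_of_mul_fixed (k := τ c / b * (d * τ d)) ?_
    (mul_ne_zero (div_ne_zero hτc hb0) (mul_ne_zero hd hτd)) ?_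
  · rw [map_mul, map_div₀, map_mul, hττ, hττ, mul_comm d, (div_eq_div_iff hτb hb0).mpr]
    linear_combination -hbc
  · have e : τ c / b * (d * τ d) * (b * d ^ 3 * (y ^ 4 + τ y)) =
        τ (c * d ^ (2 ^ s + 1) * (y ^ 2 ^ s + y)) := by
      rw [pow_succ d (2 ^ s), hs, hs]
      simp only [map_mul, map_add, map_pow, hττ]
      field_simp
    rw [e, h2, h2]

/-- Here `σ` is the Frobenius power `x ↦ x ^ 2 ^ s`, and the hypothesis `hσφ` says that the
Frobenius is `τ ∘ σ⁻²`. Applying `σ ^ 2` to the first trace condition brings the pair of conditions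
into the form of `eq_zero_or_one_of_trace` with `w = c * (d * σ d)`. -/
theorem eq_zero_or_one_of_sq_eq_conj {σ : F →+* F} (hττ : ∀ x, τ (τ x) = x)
    (hτσ : ∀ x, τ (σ x) = σ (τ x)) (hfix : ∀ x, τ x = x → IsCube x)
    (hσ : ∀ x, IsCube (x * σ x)) (hσfix : ∀ x, σ x = x → x = 0 ∨ x = 1)
    (hσφ : ∀ x, σ (σ (x ^ 2)) = τ x) {b c d y : F}
    (hb : ¬ IsCube b) (hc : c ≠ 0) (hd : d ≠ 0)
    (hcb : τ (σ c / c / σ (σ b)) = σ c / c / σ (σ b))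
    (h1 : τ (b * d ^ 3 * (y ^ 2 + y)) = b * d ^ 3 * (y ^ 2 + y))
    (h2 : τ (c * (d * σ d) * (σ y + y)) = c * (d * σ d) * (σ y + y)) :
    y = 0 ∨ y = 1 := by
  have hb0 := not_isCube_ne_zero hb
  have hσ0 {x : F} (hx : x ≠ 0) : σ x ≠ 0 := by simpa using hx
  have hτd : τ d ≠ 0 := by simpa using hd
  have hσσb := hσ0 (hσ0 hb0)
  have hk : σ c / c / σ (σ b) ≠ 0 := div_ne_zero (div_ne_zero (hσ0 hc) hc) hσσb
  have hd2 : σ (σ d) ^ 2 = τ d := by rw [← hσφ d, map_pow, map_pow]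
  have hN : τ (d * τ d)⁻¹ = (d * τ d)⁻¹ := by rw [map_inv₀, map_mul, hττ, mul_comm]
  have hσd := hσ0 hd
  -- Modulo nonzero elements fixed by `τ`, the quotient `σ w / w` is `σ (σ (b * d ^ 3))`.
  have hw : σ (c * (d * σ d)) / (c * (d * σ d)) =
      σ c / c / σ (σ b) * (d * τ d)⁻¹ * σ (σ (b * d ^ 3)) := by
    simp only [map_mul, map_pow]
    field_simp
    linear_combination -(σ c * σ (σ d)) * hd2
  have hwc : ¬ IsCube (c * (d * σ d)) := fun h ↦ by
    have h3 := (h.map σ).div h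
    rw [hw] at h3
    have h4 := ((hfix _ hcb).mul (hfix _ hN)).of_mul_left
      (mul_ne_zero hk (inv_ne_zero (mul_ne_zero hd hτd))) h3
    have hu0 : b * d ^ 3 ≠ 0 := mul_ne_zero hb0 (pow_ne_zero 3 hd)
    have h5 := h4.of_mul_left (hσ0 (hσ0 hu0)) (by rw [mul_comm]; exact hσ (σ (b * d ^ 3)))
    exact not_isCube_mul_pow_three hb hd
      (h5.of_mul_left (hσ0 hu0) (by rw [mul_comm]; exact hσ (b * d ^ 3)))
  refine eq_zero_or_one_of_trace hττ hτσ hfix hσ hσfix hwc h2 ?_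
  have h6 : τ (σ (σ (b * d ^ 3 * (y ^ 2 + y)))) = σ (σ (b * d ^ 3 * (y ^ 2 + y))) := by
    rw [hτσ, hτσ, h1]
  have h7 : σ (σ (b * d ^ 3 * (y ^ 2 + y))) = σ (σ (b * d ^ 3)) * (σ (σ y) + τ y) := by
    rw [map_mul, map_mul, map_add, map_add, hσφ, add_comm (τ y)]
  rw [hw, mul_assoc, ← h7, map_mul, h6, map_mul, hcb, hN]

theorem eq_zero_or_one_of_pow_eq_conj (hττ : ∀ x, τ (τ x) = x)
    (hfix : ∀ x, τ x = x → IsCube x) {s : ℕ} (hs : ∀ x : F, x ^ 2 ^ s = τ x) {b c d y : F}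
    (hb : ¬ IsCube b) (hc : τ c ≠ c) (hd : d ≠ 0)
    (h1 : τ (b * d ^ 3 * (y ^ 2 + y)) = b * d ^ 3 * (y ^ 2 + y))
    (h2 : τ (c * d ^ (2 ^ s + 1) * (y ^ 2 ^ s + y)) = c * d ^ (2 ^ s + 1) * (y ^ 2 ^ s + y)) :
    y = 0 ∨ y = 1 := by
  have hτd : τ d ≠ 0 := by simpa using hd
  rw [pow_succ, hs, hs] at h2
  simp only [map_mul, map_add, hττ] at h2
  have hy : τ y + y = 0 := by
    have : (τ c - c) * ((d * τ d) * (τ y + y)) = 0 := by linear_combination h2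
    simpa [sub_eq_zero, hc, hd] using this
  have hy' := CharTwo.add_eq_zero.mp hy
  by_contra hy01
  have hv0 : y ^ 2 + y ≠ 0 := fun h ↦
    hy01 (eq_zero_or_one_of_sq_eq_self (CharTwo.add_eq_zero.mp h))
  exact not_isCube_of_mul_fixed hfix (not_isCube_mul_pow_three hb hd) hv0 h1
    (hfix _ (by simp [hy']))

theorem eq_zero_or_one_of_pow_sq_eq_self {s : ℕ} (hs : ∀ x : F, (x ^ 2 ^ s) ^ 2 = x) {b c d y : F}
    (hb : b ≠ 0) (hd : d ≠ 0) (hcb : τ (c ^ 2 / b) ≠ c ^ 2 / b)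
    (h1 : τ (b * d ^ 3 * (y ^ 2 + y)) = b * d ^ 3 * (y ^ 2 + y))
    (h2 : τ (c * d ^ (2 ^ s + 1) * (y ^ 2 ^ s + y)) = c * d ^ (2 ^ s + 1) * (y ^ 2 ^ s + y)) :
    y = 0 ∨ y = 1 := by
  by_contra hy01
  have hv0 : y ^ 2 + y ≠ 0 := fun h ↦
    hy01 (eq_zero_or_one_of_sq_eq_self (CharTwo.add_eq_zero.mp h))
  have e : c ^ 2 / b =
      (c * d ^ (2 ^ s + 1) * (y ^ 2 ^ s + y)) ^ 2 / (b * d ^ 3 * (y ^ 2 + y)) := by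
    rw [mul_pow, mul_pow, add_pow_char _ _ 2, pow_succ d (2 ^ s), mul_pow, hs, hs, add_comm y,
      div_eq_div_iff hb (mul_ne_zero (mul_ne_zero hb (pow_ne_zero 3 hd)) hv0)]
    ring
  apply hcb
  rw [e, map_div₀, map_pow, h2, h1]

end Families

/-- If `s` is odd and `c ^ (2 ^ (2 * s) - 2 ^ s + 1) / b` lies in the subfield, this divisibility
makes `b` a quotient of two cubes, so no noncube `b` admits such a `c`. -/
theorem three_dvd_two_pow_two_mul_sub {s : ℕ} (hs : Odd s) :
    3 ∣ 2 ^ (2 * s) - 2 ^ s + 1 := by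
  obtain ⟨j, hj⟩ := three_dvd_two_pow_add_one hs
  have h2 : 1 ≤ 2 ^ s := Nat.one_le_two_pow
  obtain ⟨i, hi⟩ : ∃ i, 2 ^ s = 3 * i + 2 := ⟨j - 1, by omega⟩
  rw [mul_comm, pow_mul, hi]
  have : (3 * i + 2) ^ 2 = (3 * i + 2) + (9 * i ^ 2 + 9 * i + 2) := by ring
  rw [this, Nat.add_sub_cancel_left]
  exact ⟨3 * i ^ 2 + 3 * i + 1, by ring⟩

theorem theorem3p1 {F : Type*} [Field F] (m n : ℕ) (hm : Odd m) (hn : n = 2 * m)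
    (hF : Nat.card F = 2 ^ n)
    -- `K` is the subfield with `2^m` elements
    (K : Subfield F) (hK : Nat.card K = 2 ^ m)
    (a : F) (ha : a ∉ K) :
    (∀ (s : ℕ) (b c : F), Odd s → b * c ≠ 0 →
      (((s : ℤ) ≡ (m : ℤ) - 2 [ZMOD (n : ℤ)] ∧ ¬ IsCube b ∧ c ^ 4 / b ∈ K) ∨
        ((s : ℤ) * ((m : ℤ) - 2) ≡ 1 [ZMOD (n : ℤ)] ∧ ¬ IsCube b ∧
          c ^ (2 ^ s - 1) / b ^ (2 ^ (2 * s)) ∈ K) ∨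
        (s = 3 ∧ ¬ IsCube b ∧ c / b ^ 3 ∈ K) ∨
        (Nat.gcd 3 m = 1 ∧ 3 * s ≡ 1 [MOD n] ∧ ¬ IsCube b ∧
          c ^ (2 ^ (2 * s) - 2 ^ s + 1) / b ∈ K) ∨
        (s = m ∧ ¬ IsCube b ∧ c ∉ K) ∨
        (s = m + 2 ∧ ¬ IsCube b ∧ b * c ∈ K) ∨
        (s = n - 1 ∧ c ^ 2 / b ∉ K)) →
      IsAPN (quadrinomial n m s a b c)) ∧
    (∀ b : F, ¬ IsCube b →
      IsAPN (fun x : F => a * traceTwo n m (b * x ^ 3) +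
        a ^ (2 ^ m) * traceTwo n m (b ^ 3 * x ^ 9))) := by
  subst hn
  have hm0 : 0 < m := hm.pos
  have : Finite F := Nat.finite_of_card_ne_zero (by rw [hF]; positivity)
  have := Fintype.ofFinite F
  have : CharP F 2 := charP_of_card_eq_prime_pow (f := 2 * m) (by
    rw [← Nat.card_eq_fintype_card, hF])
  obtain ⟨τ, hτ⟩ : ∃ τ : F →+* F, ∀ x, τ x = x ^ 2 ^ m :=
    ⟨iterateFrobenius F 2 m, fun x ↦ iterateFrobenius_def ..⟩
  have hττ (x : F) : τ (τ x) = x := by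
    rw [hτ, hτ, ← pow_mul, ← pow_add, ← two_mul]
    simpa using pow_two_pow_eq_of_modEq hF (show 2 * m ≡ 0 [MOD 2 * m] by simp [Nat.ModEq]) x
  have hfix (x : F) (hx : τ x = x) : IsCube x := isCube_of_pow_eq hm (by rwa [← hτ])
  have hmem (x : F) : x ∈ K ↔ τ x = x := by
    rw [hτ]
    exact mem_subfield_iff_pow_eq K (Nat.one_lt_two_pow hm0.ne') hK x
  simp only [hmem] at ha ⊢
  have key (s : ℕ) (b c : F) := quadrinomial_isAPN hm0 hτ hττ ha (s := s) (b := b) (c := c)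
  have nine (b c : F) (hb : ¬ IsCube b) (hc : c ≠ 0) (hcb : τ (c / b ^ 3) = c / b ^ 3) :
      IsAPN (quadrinomial (2 * m) m 3 a b c) := by
    refine key 3 b c fun d y hd h1 h2 ↦ ?_
    have hb0 := not_isCube_ne_zero hb
    refine eq_zero_or_one_of_trace_nine hττ hfix (not_isCube_mul_pow_three hb hd) h1
      (fixed_of_mul_fixed hcb (div_ne_zero hc (pow_ne_zero 3 hb0)) ?_)
    have e : c / b ^ 3 * ((b * d ^ 3) ^ 3 * (y ^ 8 + y)) =
        c * d ^ (2 ^ 3 + 1) * (y ^ 2 ^ 3 + y) := by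
      field_simp
      ring
    rw [e, h2]
  refine ⟨fun s b c hs hbc h ↦ ?_, fun b hb ↦ ?_⟩
  · have hb0 := left_ne_zero_of_mul hbc
    have hc0 := right_ne_zero_of_mul hbc
    rcases h with ⟨hsm, hb, hcb⟩ | ⟨hsm, hb, hcb⟩ | ⟨rfl, hb, hcb⟩ | ⟨-, -, hb, hcb⟩ |
      ⟨rfl, hb, hc⟩ | ⟨rfl, hb, hcb⟩ | ⟨hsm, hcb⟩
    · have hsm' : s + 2 ≡ m [MOD 2 * m] := by
        rw [← Int.natCast_modEq_iff]
        simpa using hsm.add_right 2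
      have hs4 (x : F) : (x ^ 2 ^ s) ^ 4 = τ x := by
        rw [hτ, ← pow_two_pow_eq_of_modEq hF hsm', ← pow_mul, pow_add]
        norm_num
      exact key s b c fun d y hd h1 h2 ↦
        eq_zero_or_one_of_pow_mul_four hττ hfix hs4 hb hc0 hd hcb h1 h2
    · -- As `s` is odd, `s * m` is `m` modulo `2 * m`, hence `2 * s + 1` is `m`.
      have hsm' : 2 * s + 1 ≡ m [MOD 2 * m] := by
        obtain ⟨t, rfl⟩ := hs
        obtain ⟨k, hk⟩ := Int.modEq_iff_dvd.mp hsm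
        push_cast at hk
        rw [← Int.natCast_modEq_iff, Int.modEq_iff_dvd]
        exact ⟨-t - k, by push_cast; linear_combination -hk⟩
      have hsk : s * (3 * m - 2) ≡ 1 [MOD 2 * m] := by
        rw [← Int.natCast_modEq_iff]
        push_cast [show 2 ≤ 3 * m by omega] at hsm ⊢
        obtain ⟨k, hk⟩ := Int.modEq_iff_dvd.mp hsm
        exact Int.modEq_iff_dvd.mpr ⟨k - s, by linear_combination hk⟩
      obtain ⟨σ, hσ⟩ : ∃ σ : F →+* F, ∀ x, σ x = x ^ 2 ^ s :=
        ⟨iterateFrobenius F 2 s, fun x ↦ iterateFrobenius_def ..⟩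
      refine key s b c fun d y hd h1 h2 ↦ ?_
      refine eq_zero_or_one_of_sq_eq_conj (σ := σ) hττ (fun x ↦ by simp [hσ]) hfix
        (fun x ↦ ?_) (fun x hx ↦ eq_zero_or_one_of_pow_two_pow_eq hF hsk (by rw [← hσ, hx]))
        (fun x ↦ ?_) hb hc0 hd ?_ h1 (by rwa [hσ, hσ, ← pow_succ'])
      · rw [hσ, ← pow_succ']
        exact isCube_pow_of_dvd (three_dvd_two_pow_add_one hs) x
      · rw [hσ, hσ, hτ, ← pow_two_pow_eq_of_modEq hF hsm', ← pow_mul, ← pow_mul]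
        congr 1
        ring
      · have e : σ c / c / σ (σ b) = c ^ (2 ^ s - 1) / b ^ 2 ^ (2 * s) := by
          rw [hσ, hσ, hσ, ← pow_mul b, ← pow_add, ← two_mul]
          congr 1
          rw [div_eq_iff hc0, ← pow_succ, Nat.sub_add_cancel Nat.one_le_two_pow]
        rw [e, hcb]
    · exact nine b c hb hc0 hcb
    · have hc := isCube_pow_of_dvd (three_dvd_two_pow_two_mul_sub hs) c
      have := hc.div (hfix _ hcb)
      rw [div_div_cancel₀ (pow_ne_zero _ hc0)] at this
      exact absurd this hb
    · exact key _ b c fun d y hd h1 h2 ↦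
        eq_zero_or_one_of_pow_eq_conj hττ hfix (fun x ↦ (hτ x).symm) hb hc hd h1 h2
    · have hs4 (x : F) : x ^ 2 ^ (m + 2) = τ x ^ 4 := by
        rw [hτ, ← pow_mul, pow_add]
        norm_num
      exact key _ b c fun d y hd h1 h2 ↦
        eq_zero_or_one_of_pow_eq_pow_four hττ hfix hs4 hb hc0 hd hcb h1 h2
    · have hs2 (x : F) : (x ^ 2 ^ s) ^ 2 = x := by
        rw [← pow_mul, ← pow_succ, show s + 1 = 2 * m by omega]
        simpa using pow_two_pow_eq_of_modEq hF (show 2 * m ≡ 0 [MOD 2 * m] by simp [Nat.ModEq]) x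
      exact key s b c fun d y hd h1 h2 ↦
        eq_zero_or_one_of_pow_sq_eq_self hs2 hb0 hd hcb h1 h2
  · have hb0 := not_isCube_ne_zero hb
    refine nine b (b ^ 3) hb (pow_ne_zero 3 hb0) ?_
    rw [div_self (pow_ne_zero 3 hb0), map_one]
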